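/- There exists a norm on $\mathbb{R}^3$ that is $C^\infty$ on $\mathbb{R}^3\setminus\{0\}$ and admits an equilateral set of six points (that is, a set of six points whose pairwise distances in the norm all equal one common $\lambda>0$). More precisely, let $p_k=(\cos\frac{2\pi k}{12},\sin\frac{2\pi k}{12},0)$ and $e=(0,0,1)$, let $\Delta_1$ be the triangle with vertices $p_3+e,\ p_7+e,\ p_{11}+e$ and $\Delta_2$ the triangle with vertices $p_0,\ p_4,\ p_8$ (so $\Delta_2$ is a Euclidean equilateral triangle and $\Delta_1$ is a parallel copy of it, rotated by $30^\circ$), let $S=\{p_0,p_4,p_8,p_3+e,p_7+e,p_{11}+e\}$ be the set of their six vertices, and let $P=\operatorname{conv} S$. Then there is a norm on $\mathbb{R}^3$, $C^\infty$ on $\mathbb{R}^3\setminus\{0\}$, such that the six-point set $S$ is equilateral for it, and such that its unit ball $B$ contains $P-P$ and the boundary of $B$ contains the two hexagons $\pm(\Delta_1-\Delta_2)$ and the 12 vertices $x-y$ ($x\neq y$ vertices of the same triangle $\Delta_i$) of a regular dodecagon in the plane $z=0$. -/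

import Mathlib

open Real
open scoped ContDiff Pointwise

/-- Three-dimensional real space, with its usual topology. -/
abbrev R3 : Type := EuclideanSpace ℝ (Fin 3)

/-- `N` is a norm on `ℝ³` that is `C^∞` on `ℝ³ \ {0}`. -/
structure IsSmoothNorm (N : Seminorm ℝ R3) : Prop where
  eq_zero_of_map_eq_zero : ∀ x : R3, N x = 0 → x = 0
  contDiffOn : ContDiffOn ℝ ∞ (fun x : R3 => N x) {0}ᶜ

/-- The unit ball `{x | N x ≤ 1}`. -/
def unitBall (N : Seminorm ℝ R3) : Set R3 := {x | N x ≤ 1}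

/-- All distances, measured by `N`, between distinct points of `S` have one common
positive value. -/
def IsEquilateral (N : Seminorm ℝ R3) (S : Set R3) : Prop :=
  ∃ c : ℝ, 0 < c ∧ ∀ x ∈ S, ∀ y ∈ S, x ≠ y → N (x - y) = c

noncomputable section

/-- The consecutive vertices of a regular dodecagon in the `xy`-plane. -/
def dodecagonPoint (k : ℕ) : R3 :=
  !₂[cos (2 * π * k / 12), sin (2 * π * k / 12), 0]

/-- The unit vector orthogonal to the `xy`-plane. -/
def verticalUnit : R3 := !₂[0, 0, 1]

/-- The vertices of a Euclidean equilateral triangle in the plane `z = 0`. -/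
def lowerVertices : Set R3 := {dodecagonPoint 0, dodecagonPoint 4, dodecagonPoint 8}

/-- The same three vertices, rotated by `-30°` about the `z`-axis and moved to the
plane `z = 1`. -/
def upperVertices : Set R3 :=
  {dodecagonPoint 3 + verticalUnit, dodecagonPoint 7 + verticalUnit,
    dodecagonPoint 11 + verticalUnit}

/-- The six points. -/
def sixPoints : Set R3 := upperVertices ∪ lowerVertices

/-- The polytope `P` spanned by the six points. -/
def polytopeP : Set R3 := convexHull ℝ sixPoints

/-- The hexagon `Δ₁ - Δ₂`, where `Δ₁` and `Δ₂` are the upper and the lower triangle. -/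
def hexagon : Set R3 := convexHull ℝ upperVertices - convexHull ℝ lowerVertices

/-- The 12 vertices `x - y`, for `x ≠ y` vertices of the same triangle, of a regular
dodecagon in the `xy`-plane. -/
def dodecagonVertices : Set R3 :=
  {v | ∃ x y : R3, x ≠ y ∧ v = x - y ∧
    ((x ∈ upperVertices ∧ y ∈ upperVertices) ∨ (x ∈ lowerVertices ∧ y ∈ lowerVertices))}

end

/-!
The norm is a smoothing of a polyhedral norm `max i, |ℓ i x|` that does not disturb the points of
interest. Let `φ t = g (t ^ 2 - a ^ 2)`, where `g s = s * exp (-1 / s)` for `s > 0` and `g s = 0`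
otherwise. This `g` is smooth, convex and increasing, so `φ` is smooth, even and convex, and it
vanishes on `[-a, a]`. For linear functionals `ℓ i` without a common zero other than the origin, the
set `B = {x | ∑ i, φ (ℓ i x) ≤ φ 1}` is a bounded symmetric convex body. A convex function has
positive radial derivative where it exceeds its value at the origin, so by the implicit function
theorem the gauge of `B` is smooth away from the origin
(`exists_seminorm_of_convex_sublevel`). If `|ℓ i x| = 1` for one index and `|ℓ j x| ≤ a < 1` for all
others, then exactly one summand is nonzero, and `x` has norm `1`
(`exists_smooth_norm_of_functionals`).

It remains to find functionals that separate the two hexagons and the dodecagon vertices in this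
way. One is the height, which is `±1` on the hexagons `±(Δ₁ - Δ₂)` and `0` on the dodecagon. The
others are one for each pair of opposite dodecagon vertices, `1` at that vertex and with a vertical
component such that they are strictly between `-1` and `1` on the hexagons
(`facetFunctional_of_mem_hexagon`) and at the other dodecagon vertices
(`facetFunctional_of_mem_dodecagonVertices`); all these values are at most `√3 / 4 + 1 / 2` in
absolute value, and `a = 19 / 20` is a convenient larger number. Every difference of two distinct
members of the six-point set is a point of `±(Δ₁ - Δ₂)` or a dodecagon vertex, so all distances are `1`, and the ball
contains `P - P` by convexity.
-/

/-! ### A convex function vanishing on a half-line -/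

/-- The function `s ↦ s * exp (-1 / s)` on `s > 0`, extended by zero. It is convex on the whole
line (its second derivative is `exp (-1 / s) / s ^ 3` for `s > 0`), unlike `expNegInvGlue`. -/
noncomputable def convexGlue (s : ℝ) : ℝ := s * expNegInvGlue s

theorem convexGlue_of_nonpos {s : ℝ} (hs : s ≤ 0) : convexGlue s = 0 := by
  simp [convexGlue, expNegInvGlue.zero_of_nonpos hs]

theorem convexGlue_pos {s : ℝ} (hs : 0 < s) : 0 < convexGlue s :=
  mul_pos hs (expNegInvGlue.pos_of_pos hs)

theorem convexGlue_nonneg (s : ℝ) : 0 ≤ convexGlue s := by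
  rcases le_or_gt s 0 with h | h
  · exact (convexGlue_of_nonpos h).ge
  · exact (convexGlue_pos h).le

theorem contDiff_convexGlue : ContDiff ℝ ∞ convexGlue :=
  contDiff_id.mul expNegInvGlue.contDiff

theorem convexGlue_strictMonoOn : StrictMonoOn convexGlue (Set.Ici 0) := by
  intro s hs t _ hst
  have ht : 0 < t := lt_of_le_of_lt hs hst
  exact (mul_le_mul_of_nonneg_left (expNegInvGlue.monotone hst.le) hs).trans_lt
    (mul_lt_mul_of_pos_right hst (expNegInvGlue.pos_of_pos ht))

theorem convexGlue_monotone : Monotone convexGlue := by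
  intro s t hst
  rcases le_or_gt s 0 with h | h
  · simpa [convexGlue_of_nonpos h] using convexGlue_nonneg t
  · exact convexGlue_strictMonoOn.monotoneOn h.le (h.le.trans hst) hst

/-- The affine functions `s ↦ exp (-y) * (s * (1 + y) - 1)` are minorants of `convexGlue`; the one
with `y = 1 / m` is the tangent at `m > 0`, so convexity follows. -/
theorem tangent_le_convexGlue {y : ℝ} (hy : 0 ≤ y) (s : ℝ) :
    exp (-y) * (s * (1 + y) - 1) ≤ convexGlue s := by
  rcases le_or_gt s 0 with h | h
  · rw [convexGlue_of_nonpos h]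
    exact mul_nonpos_of_nonneg_of_nonpos (exp_pos _).le (by nlinarith)
  · have h1 : y - s⁻¹ + 1 ≤ exp (y - s⁻¹) := add_one_le_exp _
    have h2 : exp (-s⁻¹) = exp (-y) * exp (y - s⁻¹) := by rw [← exp_add]; ring_nf
    have h3 : s * s⁻¹ = 1 := mul_inv_cancel₀ h.ne'
    rw [convexGlue, expNegInvGlue, if_neg h.not_ge, h2]
    have h4 : s * (y - s⁻¹ + 1) ≤ s * exp (y - s⁻¹) := by gcongr
    calc exp (-y) * (s * (1 + y) - 1) = exp (-y) * (s * (y - s⁻¹ + 1)) := by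
          rw [← h3]; ring
      _ ≤ exp (-y) * (s * exp (y - s⁻¹)) := by gcongr
      _ = _ := by ring

theorem convexOn_convexGlue : ConvexOn ℝ Set.univ convexGlue := by
  refine ⟨convex_univ, fun s _ t _ a b ha hb hab => ?_⟩
  simp only [smul_eq_mul]
  rcases le_or_gt (a * s + b * t) 0 with h | h
  · rw [convexGlue_of_nonpos h]
    exact add_nonneg (mul_nonneg ha (convexGlue_nonneg s)) (mul_nonneg hb (convexGlue_nonneg t))
  · set m := a * s + b * t with hm
    have hy : 0 ≤ m⁻¹ := (inv_pos.2 h).le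
    have h1 : m * m⁻¹ = 1 := mul_inv_cancel₀ h.ne'
    calc convexGlue m = exp (-m⁻¹) * (m * (1 + m⁻¹) - 1) := by
          rw [convexGlue, expNegInvGlue, if_neg h.not_ge, mul_add, h1]; ring
      _ = a * (exp (-m⁻¹) * (s * (1 + m⁻¹) - 1)) + b * (exp (-m⁻¹) * (t * (1 + m⁻¹) - 1)) := by
          rw [hm] at *
          linear_combination exp (-(a * s + b * t)⁻¹) * hab
      _ ≤ _ := by gcongr <;> exact tangent_le_convexGlue hy _

/-! ### The gauge of a smooth convex body -/

section Gauge

variable {E : Type*} [NormedAddCommGroup E] [NormedSpace ℝ E]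

/-- Wherever a convex function exceeds its value at the origin, its radial derivative is positive.
This is what makes the implicit function theorem applicable on a level set. -/
theorem ConvexOn.sub_le_fderiv_apply_self {F : E → ℝ} (hF : ConvexOn ℝ Set.univ F) {y : E}
    (hd : DifferentiableAt ℝ F y) : F y - F 0 ≤ fderiv ℝ F y y := by
  have hconv : ConvexOn ℝ Set.univ (fun t : ℝ => F (t • y)) :=
    hF.comp_linearMap (LinearMap.toSpanSingleton ℝ E y)
  have hline : HasDerivAt (fun t : ℝ => t • y) y 1 := by
    simpa using (hasDerivAt_id (1 : ℝ)).smul_const y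
  have hder : HasDerivAt (fun t : ℝ => F (t • y)) (fderiv ℝ F y y) 1 := by
    have h : HasFDerivAt F (fderiv ℝ F y) ((1 : ℝ) • y) := by simpa using hd.hasFDerivAt
    exact h.comp_hasDerivAt 1 hline
  simpa [slope_def_field] using
    hconv.slope_le_of_hasDerivAt (Set.mem_univ 0) (Set.mem_univ 1) one_pos hder

/-- If dividing each `x ≠ 0` by `N x` brings it to the level set `{F = c}` of a convex smooth
function `F`, and `N` is continuous and positive, then `N` is smooth away from `0`, by the implicit function theorem applied to
`(x, t) ↦ F (t • x)`. -/
theorem contDiffAt_of_inv_smul_mem_level [CompleteSpace E] {F : E → ℝ}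
    (hF : ConvexOn ℝ Set.univ F) (hs : ContDiff ℝ ∞ F) {c : ℝ} (h0 : F 0 < c) {N : E → ℝ}
    (hN : Continuous N) (hpos : ∀ x, x ≠ 0 → 0 < N x) (hlev : ∀ x, x ≠ 0 → F ((N x)⁻¹ • x) = c)
    {x : E} (hx : x ≠ 0) : ContDiffAt ℝ ∞ N x := by
  set f : E × ℝ → ℝ := fun v => F (v.2 • v.1) with hf
  set u : E × ℝ := (x, (N x)⁻¹) with hu
  have hfs : ContDiff ℝ ∞ f := hs.comp (contDiff_snd.smul contDiff_fst)
  have hnx := hpos x hx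
  have hd : HasDerivAt (fun t : ℝ => F (t • x)) (fderiv ℝ F ((N x)⁻¹ • x) x) (N x)⁻¹ := by
    have hline : HasDerivAt (fun t : ℝ => t • x) x (N x)⁻¹ := by
      simpa using (hasDerivAt_id (N x)⁻¹).smul_const x
    exact ((hs.differentiable (by simp)) _).hasFDerivAt.comp_hasDerivAt _ hline
  have hd' : HasDerivAt (fun t : ℝ => F (t • x)) (fderiv ℝ f u (0, 1)) (N x)⁻¹ := by
    have hpt : HasDerivAt (fun t : ℝ => (x, t)) ((0 : E), (1 : ℝ)) (N x)⁻¹ :=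
      (hasDerivAt_const _ x).prodMk (hasDerivAt_id _)
    exact ((hfs.differentiable (by simp)) u).hasFDerivAt.comp_hasDerivAt _ hpt
  have hne : fderiv ℝ f u (0, 1) ≠ 0 := by
    rw [hd'.unique hd]
    intro h
    have h1 := hF.sub_le_fderiv_apply_self ((hs.differentiable (by simp)) ((N x)⁻¹ • x))
    rw [map_smul, h, hlev x hx, smul_zero] at h1
    linarith
  have hinv : (fderiv ℝ f u ∘L .inr ℝ E ℝ).IsInvertible := by
    refine ⟨ContinuousLinearEquiv.unitsEquivAut ℝ (Units.mk0 _ hne), ?_⟩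
    ext
    simp
  have hcd : ContDiffAt ℝ ∞ f u := hfs.contDiffAt
  have hn : (∞ : WithTop ℕ∞) ≠ 0 := by simp
  set ψ := hcd.implicitFunction hn hinv with hψ
  have hψs : ContDiffAt ℝ ∞ ψ x := hcd.contDiffAt_implicitFunction hn hinv
  have hψx : ψ x = (N x)⁻¹ := hcd.implicitFunction_apply_self hn hinv
  have htend : Filter.Tendsto (fun z => (z, (N z)⁻¹)) (nhds x) (nhds u) :=
    (continuousAt_id.prodMk (hN.continuousAt.inv₀ hnx.ne') :)
  have heq : N =ᶠ[nhds x] fun z => (ψ z)⁻¹ := by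
    filter_upwards [htend.eventually (hcd.eventually_apply_eq_iff_implicitFunction hn hinv),
      isOpen_ne.mem_nhds hx] with z hz hz0
    have h1 : ψ z = (N z)⁻¹ := hz.1 (by simp only [hf, hu]; rw [hlev z hz0, hlev x hx])
    rw [h1, inv_inv]
  refine ContDiffAt.congr_of_eventuallyEq (hψs.inv ?_) heq
  rw [hψx]
  exact inv_ne_zero hnx.ne'

/-- The gauge of a bounded sublevel set of an even convex smooth function is a smooth norm whose
unit sphere is the level set. -/
theorem exists_seminorm_of_convex_sublevel [FiniteDimensional ℝ E] {F : E → ℝ}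
    (hF : ConvexOn ℝ Set.univ F) (hs : ContDiff ℝ ∞ F) (heven : ∀ x, F (-x) = F x) {c : ℝ}
    (h0 : F 0 < c) (hb : Bornology.IsBounded {x | F x ≤ c}) :
    ∃ N : Seminorm ℝ E, (∀ x, N x = 0 → x = 0) ∧
      ContDiffOn ℝ ∞ (fun x => N x) {0}ᶜ ∧ ∀ x, N x = 1 ↔ F x = c := by
  have : CompleteSpace E := FiniteDimensional.complete ℝ E
  set B : Set E := {x | F x ≤ c} with hB
  have hconv : Convex ℝ B := by simpa [hB] using hF.convex_le c
  have hnhds : B ∈ nhds (0 : E) :=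
    Filter.mem_of_superset (hs.continuous.continuousAt.eventually_lt continuousAt_const h0)
      fun x hx => (show F x < c from hx).le
  have habs : Absorbent ℝ B := absorbent_nhds_zero hnhds
  have hbal : Balanced ℝ B :=
    (balanced_iff_neg_mem hconv).2 fun x hx => by simpa [hB, heven] using hx
  set N : Seminorm ℝ E := gaugeSeminorm hbal hconv habs with hN
  have hNg : ∀ x, N x = gauge B x := fun x => rfl
  have hcont : Continuous N := continuous_gauge hconv hnhds
  have hpos : ∀ x, x ≠ 0 → 0 < N x := fun x hx =>
    (gauge_pos habs (NormedSpace.isVonNBounded_iff ℝ |>.2 hb)).2 hx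
  have hone : ∀ x, N x = 1 ↔ F x = c := by
    intro x
    rw [hNg]
    constructor
    · intro h
      exact frontier_le_subset_eq hs.continuous continuous_const
        ((gauge_eq_one_iff_mem_frontier hconv hnhds).1 h)
    · intro h
      refine le_antisymm (gauge_le_one_of_mem h.le) (le_of_not_gt fun hlt => ?_)
      obtain ⟨r, hr0, hr1, y, hy, rfl⟩ := exists_lt_of_gauge_lt habs hlt
      have h1 := hF.2 (Set.mem_univ y) (Set.mem_univ 0) hr0.le (sub_nonneg.2 hr1.le) (by ring)
      simp only [smul_zero, add_zero, smul_eq_mul] at h1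
      have h2 : F y ≤ c := hy
      simp only at h
      nlinarith
  refine ⟨N, fun x hx => by_contra fun h => (hpos x h).ne' hx, fun x hx => ?_, hone⟩
  refine (contDiffAt_of_inv_smul_mem_level hF hs h0 hcont hpos (fun z hz => ?_) hx).contDiffWithinAt
  rw [← hone, map_smul_eq_mul, norm_inv, norm_eq_abs, abs_of_pos (hpos z hz),
    inv_mul_cancel₀ (hpos z hz).ne']

/-- A smoothing of the polyhedral norm `max i, |ℓ i x|` that keeps the value `1` at the points of
each facet that stay away from the planes of all other facets. -/
theorem exists_smooth_norm_of_functionals [FiniteDimensional ℝ E] {ι : Type*} [Fintype ι]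
    (ℓ : ι → E →L[ℝ] ℝ) (hℓ : ∀ x, (∀ i, ℓ i x = 0) → x = 0) {a : ℝ} (ha0 : 0 ≤ a) (ha1 : a < 1) :
    ∃ N : Seminorm ℝ E, (∀ x, N x = 0 → x = 0) ∧
      ContDiffOn ℝ ∞ (fun x => N x) {0}ᶜ ∧
      ∀ x i, |ℓ i x| = 1 → (∀ j, j ≠ i → |ℓ j x| ≤ a) → N x = 1 := by
  set F : E → ℝ := fun x => ∑ i, convexGlue (ℓ i x ^ 2 - a ^ 2) with hFdef
  set c : ℝ := convexGlue (1 - a ^ 2) with hc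
  have ha : 0 < 1 - a ^ 2 := by nlinarith
  have hg : ConvexOn ℝ Set.univ fun t : ℝ => convexGlue (t ^ 2 - a ^ 2) := by
    refine ⟨convex_univ, fun s _ t _ p q hp hq hpq => ?_⟩
    refine (convexGlue_monotone ?_).trans
      (convexOn_convexGlue.2 (Set.mem_univ (s ^ 2 - a ^ 2)) (Set.mem_univ (t ^ 2 - a ^ 2)) hp hq hpq)
    have := (even_two.convexOn_pow (𝕜 := ℝ)).2 (Set.mem_univ s) (Set.mem_univ t) hp hq hpq
    simp only [smul_eq_mul] at this ⊢
    linear_combination this + a ^ 2 * hpq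
  have hF : ConvexOn ℝ Set.univ F := by
    refine ⟨convex_univ, fun x _ y _ p q hp hq hpq => ?_⟩
    simp only [hFdef, smul_eq_mul, Finset.mul_sum, ← Finset.sum_add_distrib]
    exact Finset.sum_le_sum fun i _ => by
      simpa using hg.2 (Set.mem_univ (ℓ i x)) (Set.mem_univ (ℓ i y)) hp hq hpq
  have hs : ContDiff ℝ ∞ F :=
    ContDiff.sum fun i _ => contDiff_convexGlue.comp (((ℓ i).contDiff.pow 2).sub contDiff_const)
  have h0 : F 0 < c := by
    have : F 0 = 0 := Finset.sum_eq_zero fun i _ =>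
      convexGlue_of_nonpos (by simpa using sq_nonneg a)
    rw [this]
    exact convexGlue_pos ha
  have hle : ∀ x, F x ≤ c → ∀ i, |ℓ i x| ≤ 1 := by
    intro x hx i
    by_contra! h
    have h1 : c < convexGlue (ℓ i x ^ 2 - a ^ 2) :=
      convexGlue_strictMonoOn ha.le (by nlinarith [sq_abs (ℓ i x)] : (0 : ℝ) ≤ _)
        (by nlinarith [sq_abs (ℓ i x)])
    have h2 : convexGlue (ℓ i x ^ 2 - a ^ 2) ≤ F x :=
      Finset.single_le_sum (f := fun i => convexGlue (ℓ i x ^ 2 - a ^ 2))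
        (fun j _ => convexGlue_nonneg _) (Finset.mem_univ i)
    linarith
  have hb : Bornology.IsBounded {x | F x ≤ c} := by
    set L : E →L[ℝ] (ι → ℝ) := ContinuousLinearMap.pi ℓ with hL
    have hker : LinearMap.ker L.toLinearMap = ⊥ :=
      LinearMap.ker_eq_bot'.2 fun x hx => hℓ x fun i => congrFun hx i
    obtain ⟨K, _, hK⟩ := L.toLinearMap.exists_antilipschitzWith hker
    refine (hK.isBounded_preimage (Metric.isBounded_closedBall (x := 0) (r := 1))).subset ?_
    intro x hx
    simp only [Set.mem_preimage, mem_closedBall_zero_iff]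
    exact (pi_norm_le_iff_of_nonneg zero_le_one).2 fun i => hle x hx i
  obtain ⟨N, h1, h2, h3⟩ := exists_seminorm_of_convex_sublevel hF hs (fun x => by
    simp [hFdef]) h0 hb
  refine ⟨N, h1, h2, fun x i hi hj => (h3 x).2 ?_⟩
  have : F x = convexGlue (ℓ i x ^ 2 - a ^ 2) :=
    Finset.sum_eq_single i (fun j _ hji => convexGlue_of_nonpos
      (sub_nonpos.2 (sq_le_sq.2 ((hj j hji).trans (le_abs_self a))))) (by simp)
  rw [this, ← sq_abs, hi, one_pow]

end Gauge

/-! ### The supporting planes of the polytope -/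

section Facets

@[simp] theorem dodecagonPoint_zero : dodecagonPoint 0 = !₂[1, 0, 0] := by
  simp [dodecagonPoint]

@[simp] theorem dodecagonPoint_three : dodecagonPoint 3 = !₂[0, 1, 0] := by
  have h : 2 * π * (3 : ℕ) / 12 = π / 2 := by push_cast; ring
  simp only [dodecagonPoint, h, cos_pi_div_two, sin_pi_div_two]

@[simp] theorem dodecagonPoint_four : dodecagonPoint 4 = !₂[-(1 / 2), √3 / 2, 0] := by
  have h : 2 * π * (4 : ℕ) / 12 = π - π / 3 := by push_cast; ring
  simp only [dodecagonPoint, h, cos_pi_sub, sin_pi_sub, cos_pi_div_three, sin_pi_div_three]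

@[simp] theorem dodecagonPoint_seven : dodecagonPoint 7 = !₂[-(√3 / 2), -(1 / 2), 0] := by
  have h : 2 * π * (7 : ℕ) / 12 = π / 6 + π := by push_cast; ring
  simp only [dodecagonPoint, h, cos_add_pi, sin_add_pi, cos_pi_div_six, sin_pi_div_six]

@[simp] theorem dodecagonPoint_eight : dodecagonPoint 8 = !₂[-(1 / 2), -(√3 / 2), 0] := by
  have h : 2 * π * (8 : ℕ) / 12 = π / 3 + π := by push_cast; ring
  simp only [dodecagonPoint, h, cos_add_pi, sin_add_pi, cos_pi_div_three, sin_pi_div_three]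

@[simp] theorem dodecagonPoint_eleven : dodecagonPoint 11 = !₂[√3 / 2, -(1 / 2), 0] := by
  have h : 2 * π * (11 : ℕ) / 12 = 2 * π - π / 6 := by push_cast; ring
  simp only [dodecagonPoint, h, cos_two_pi_sub, sin_two_pi_sub, cos_pi_div_six, sin_pi_div_six]

/-- Normals of planes supporting `P - P`: that of index `0` carries the hexagon `Δ₁ - Δ₂`, and the
planes of index `1, …, 6` touch `P - P` only at the dodecagon vertex of argument `0°, 30°, …, 150°`.
The vertical component `±√3 / 12` lies midway between the values for which the plane through the
dodecagon vertex meets the upper and the lower hexagon. -/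
noncomputable def facetNormal : Fin 7 → R3 :=
  ![!₂[0, 0, 1],
    !₂[√3 / 3, 0, √3 / 12],
    !₂[1 / 2, √3 / 6, √3 / 12],
    !₂[√3 / 6, 1 / 2, -(√3 / 12)],
    !₂[0, √3 / 3, -(√3 / 12)],
    !₂[-(√3 / 6), 1 / 2, √3 / 12],
    !₂[-(1 / 2), √3 / 6, √3 / 12]]

/-- The linear functional with value `1` on the plane with normal `facetNormal i`. -/
noncomputable def facetFunctional (i : Fin 7) : R3 →L[ℝ] ℝ := innerSL ℝ (facetNormal i)

theorem facetFunctional_apply (x : R3) (i : Fin 7) : facetFunctional i x =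
    ![x 2, √3 / 3 * x 0 + √3 / 12 * x 2, 1 / 2 * x 0 + √3 / 6 * x 1 + √3 / 12 * x 2,
      √3 / 6 * x 0 + 1 / 2 * x 1 - √3 / 12 * x 2, √3 / 3 * x 1 - √3 / 12 * x 2,
      -(√3 / 6) * x 0 + 1 / 2 * x 1 + √3 / 12 * x 2,
      -(1 / 2) * x 0 + √3 / 6 * x 1 + √3 / 12 * x 2] i := by
  fin_cases i <;>
  · simp [facetFunctional, facetNormal, PiLp.inner_apply, Fin.sum_univ_three]
    try ring

theorem eq_zero_of_facetFunctional_eq_zero (x : R3) (h : ∀ i, facetFunctional i x = 0) :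
    x = 0 := by
  have h3 : (0 : ℝ) < √3 := by positivity
  have h0 := h 0
  have h1 := h 1
  have h4 := h 4
  simp only [facetFunctional_apply] at h0 h1 h4
  simp at h0 h1 h4
  simp [h0] at h1 h4
  ext i
  fin_cases i <;> simp [h0, h1, h4]

/-- On `Δ₁ - Δ₂` the functional of index `0` is `1` and all others stay away from `±1`. -/
theorem facetFunctional_of_mem_hexagon {v : R3} (hv : v ∈ hexagon) :
    facetFunctional 0 v = 1 ∧ ∀ j, j ≠ 0 → |facetFunctional j v| ≤ 19 / 20 := by
  have hconv : Convex ℝ {v : R3 | facetFunctional 0 v = 1 ∧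
      ∀ j, j ≠ 0 → |facetFunctional j v| ≤ 19 / 20} := by
    rintro x ⟨hx, hx'⟩ y ⟨hy, hy'⟩ p q hp hq hpq
    refine ⟨by simp [hx, hy, hpq], fun j hj => ?_⟩
    have h1 := abs_le.1 (hx' j hj)
    have h2 := abs_le.1 (hy' j hj)
    simp only [map_add, map_smul, smul_eq_mul]
    rw [abs_le]
    constructor <;> nlinarith
  rw [hexagon, ← convexHull_sub] at hv
  refine convexHull_min ?_ hconv hv
  have h3 : √3 * √3 = 3 := mul_self_sqrt (by norm_num)
  have h3l : 1.7 < √3 := lt_sqrt_of_sq_lt (by norm_num)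
  have h3u : √3 < 1.75 := (sqrt_lt' (by norm_num)).2 (by norm_num)
  rintro _ ⟨x, hx, y, hy, rfl⟩
  simp only [upperVertices, lowerVertices, Set.mem_insert_iff, Set.mem_singleton_iff,
    dodecagonPoint_zero, dodecagonPoint_three, dodecagonPoint_four, dodecagonPoint_seven,
    dodecagonPoint_eight, dodecagonPoint_eleven, verticalUnit] at hx hy
  have key : ∀ v : R3, v 2 = 1 → |√3 / 3 * v 0 + √3 / 12| ≤ 19 / 20 →
      |1 / 2 * v 0 + √3 / 6 * v 1 + √3 / 12| ≤ 19 / 20 →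
      |√3 / 6 * v 0 + 1 / 2 * v 1 - √3 / 12| ≤ 19 / 20 → |√3 / 3 * v 1 - √3 / 12| ≤ 19 / 20 →
      |-(√3 / 6) * v 0 + 1 / 2 * v 1 + √3 / 12| ≤ 19 / 20 →
      |-(1 / 2) * v 0 + √3 / 6 * v 1 + √3 / 12| ≤ 19 / 20 →
      facetFunctional 0 v = 1 ∧ ∀ j, j ≠ 0 → |facetFunctional j v| ≤ 19 / 20 := by
    intro v h0 h1 h2 h3 h4 h5 h6
    refine ⟨by simpa [facetFunctional_apply] using h0, fun j hj => ?_⟩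
    rw [facetFunctional_apply, h0, mul_one]
    fin_cases j
    exacts [absurd rfl hj, h1, h2, h3, h4, h5, h6]
  rcases hx with rfl | rfl | rfl <;> rcases hy with rfl | rfl | rfl <;> apply key <;>
    simp only [PiLp.sub_apply, PiLp.add_apply, Matrix.cons_val, abs_le] <;>
    first | (constructor <;> linarith) | norm_num

/-- The edges of the two triangles, up to sign. -/
theorem eq_or_neg_eq_of_mem_dodecagonVertices {v : R3} (hv : v ∈ dodecagonVertices) :
    ∃ p q : ℝ, (v = !₂[p, q, 0] ∨ -v = !₂[p, q, 0]) ∧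
      ((p = √3 ∧ q = 0) ∨ (p = 3 / 2 ∧ q = √3 / 2) ∨ (p = √3 / 2 ∧ q = 3 / 2) ∨
      (p = 0 ∧ q = √3) ∨ (p = -(√3 / 2) ∧ q = 3 / 2) ∨ (p = -(3 / 2) ∧ q = √3 / 2)) := by
  have ext3 : ∀ (w : R3) (p q : ℝ), w 0 = p → w 1 = q → w 2 = 0 → w = !₂[p, q, 0] := by
    intro w p q h0 h1 h2
    ext i
    fin_cases i
    exacts [h0, h1, h2]
  obtain ⟨x, y, hxy, rfl, ⟨hx, hy⟩ | ⟨hx, hy⟩⟩ := hv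
  · simp only [upperVertices, Set.mem_insert_iff, Set.mem_singleton_iff, verticalUnit,
      dodecagonPoint_three, dodecagonPoint_seven, dodecagonPoint_eleven] at hx hy
    rcases hx with rfl | rfl | rfl <;> rcases hy with rfl | rfl | rfl
    · exact absurd rfl hxy
    · refine ⟨_, _, .inl (ext3 _ _ _ ?_ ?_ ?_), .inr (.inr (.inl ⟨rfl, rfl⟩))⟩ <;> simp
      ring
    · refine ⟨_, _, .inl (ext3 _ _ _ ?_ ?_ ?_), .inr (.inr (.inr (.inr (.inl ⟨rfl, rfl⟩))))⟩ <;> simp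
      ring
    · refine ⟨_, _, .inr (ext3 _ _ _ ?_ ?_ ?_), .inr (.inr (.inl ⟨rfl, rfl⟩))⟩ <;> simp
      ring
    · exact absurd rfl hxy
    · refine ⟨_, _, .inr (ext3 _ _ _ ?_ ?_ ?_), .inl ⟨rfl, rfl⟩⟩ <;> simp
    · refine ⟨_, _, .inr (ext3 _ _ _ ?_ ?_ ?_), .inr (.inr (.inr (.inr (.inl ⟨rfl, rfl⟩))))⟩ <;> simp
      ring
    · refine ⟨_, _, .inl (ext3 _ _ _ ?_ ?_ ?_), .inl ⟨rfl, rfl⟩⟩ <;> simp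
    · exact absurd rfl hxy
  · simp only [lowerVertices, Set.mem_insert_iff, Set.mem_singleton_iff,
      dodecagonPoint_zero, dodecagonPoint_four, dodecagonPoint_eight] at hx hy
    rcases hx with rfl | rfl | rfl <;> rcases hy with rfl | rfl | rfl
    · exact absurd rfl hxy
    · refine ⟨_, _, .inr (ext3 _ _ _ ?_ ?_ ?_), .inr (.inr (.inr (.inr (.inr ⟨rfl, rfl⟩))))⟩ <;> simp
      ring
    · refine ⟨_, _, .inl (ext3 _ _ _ ?_ ?_ ?_), .inr (.inl ⟨rfl, rfl⟩)⟩ <;> simp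
      ring
    · refine ⟨_, _, .inl (ext3 _ _ _ ?_ ?_ ?_), .inr (.inr (.inr (.inr (.inr ⟨rfl, rfl⟩))))⟩ <;> simp
      ring
    · exact absurd rfl hxy
    · refine ⟨_, _, .inl (ext3 _ _ _ ?_ ?_ ?_), .inr (.inr (.inr (.inl ⟨rfl, rfl⟩)))⟩ <;> simp
    · refine ⟨_, _, .inr (ext3 _ _ _ ?_ ?_ ?_), .inr (.inl ⟨rfl, rfl⟩)⟩ <;> simp
      ring
    · refine ⟨_, _, .inr (ext3 _ _ _ ?_ ?_ ?_), .inr (.inr (.inr (.inl ⟨rfl, rfl⟩)))⟩ <;> simp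
    · exact absurd rfl hxy

/-- At each dodecagon vertex one functional is `±1`, and all others stay away from `±1`. -/
theorem facetFunctional_of_mem_dodecagonVertices {v : R3} (hv : v ∈ dodecagonVertices) :
    ∃ i, |facetFunctional i v| = 1 ∧ ∀ j, j ≠ i → |facetFunctional j v| ≤ 19 / 20 := by
  have h3 : √3 * √3 = 3 := mul_self_sqrt (by norm_num)
  have h3l : 1.7 < √3 := lt_sqrt_of_sq_lt (by norm_num)
  have h3u : √3 < 1.75 := (sqrt_lt' (by norm_num)).2 (by norm_num)
  obtain ⟨p, q, hpq, hlist⟩ := eq_or_neg_eq_of_mem_dodecagonVertices hv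
  have key : ∀ i : Fin 7, |facetFunctional i v| = |![0, √3 / 3 * p, 1 / 2 * p + √3 / 6 * q,
      √3 / 6 * p + 1 / 2 * q, √3 / 3 * q, -(√3 / 6) * p + 1 / 2 * q,
      -(1 / 2) * p + √3 / 6 * q] i| := by
    intro i
    have h : |facetFunctional i v| = |facetFunctional i !₂[p, q, 0]| := by
      rcases hpq with h | h
      · rw [h]
      · rw [← h, map_neg, abs_neg]
    rw [h, facetFunctional_apply]
    fin_cases i <;> simp
  suffices h : ∃ i, ![0, √3 / 3 * p, 1 / 2 * p + √3 / 6 * q,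
      √3 / 6 * p + 1 / 2 * q, √3 / 3 * q, -(√3 / 6) * p + 1 / 2 * q,
      -(1 / 2) * p + √3 / 6 * q] i = 1 ∧ ∀ j, j ≠ i → |![0, √3 / 3 * p, 1 / 2 * p + √3 / 6 * q,
      √3 / 6 * p + 1 / 2 * q, √3 / 3 * q, -(√3 / 6) * p + 1 / 2 * q,
      -(1 / 2) * p + √3 / 6 * q] j| ≤ 19 / 20 by
    obtain ⟨i, hi, hj⟩ := h
    exact ⟨i, by rw [key, hi, abs_one], fun j hji => by rw [key]; exact hj j hji⟩
  rcases hlist with ⟨rfl, rfl⟩ | ⟨rfl, rfl⟩ | ⟨rfl, rfl⟩ | ⟨rfl, rfl⟩ | ⟨rfl, rfl⟩ | ⟨rfl, rfl⟩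
  on_goal 1 => refine ⟨1, ?_, fun j hj => ?_⟩
  on_goal 3 => refine ⟨2, ?_, fun j hj => ?_⟩
  on_goal 5 => refine ⟨3, ?_, fun j hj => ?_⟩
  on_goal 7 => refine ⟨4, ?_, fun j hj => ?_⟩
  on_goal 9 => refine ⟨5, ?_, fun j hj => ?_⟩
  on_goal 11 => refine ⟨6, ?_, fun j hj => ?_⟩
  all_goals first
    | (simp only [Matrix.cons_val]; linarith)
    | (rw [abs_le]
       fin_cases j <;> first
        | exact absurd rfl hj
        | (constructor <;> simp only [Fin.mk_zero, Fin.mk_one, Fin.reduceFinMk, Matrix.cons_val] <;>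
            linarith))

end Facets

/-! ### The six points are equilateral -/

theorem mem_frontier_unitBall {N : Seminorm ℝ R3} {x : R3} (hx : N x = 1) :
    x ∈ frontier (unitBall N) := by
  refine ⟨subset_closure hx.le, fun hint => ?_⟩
  have htend : Filter.Tendsto (fun t : ℝ => t • x) (nhdsWithin 1 (Set.Ioi 1)) (nhds x) := by
    have h : Filter.Tendsto (fun t : ℝ => t • x) (nhds 1) (nhds ((1 : ℝ) • x)) :=
      (continuous_id.smul continuous_const).tendsto 1
    rw [one_smul] at h
    exact h.mono_left nhdsWithin_le_nhds
  obtain ⟨t, ht, ht1⟩ := ((htend.eventually (mem_interior_iff_mem_nhds.1 hint)).and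
    self_mem_nhdsWithin).exists
  have h1 : N (t • x) ≤ 1 := ht
  have h2 : 1 < t := ht1
  rw [map_smul_eq_mul, hx, mul_one, norm_eq_abs] at h1
  exact absurd (h2.trans_le (le_abs_self t)) h1.not_gt

theorem sub_mem_hexagon {x y : R3} (hx : x ∈ upperVertices) (hy : y ∈ lowerVertices) :
    x - y ∈ hexagon :=
  Set.sub_mem_sub (subset_convexHull ℝ _ hx) (subset_convexHull ℝ _ hy)

theorem ncard_sixPoints : sixPoints.ncard = 6 := by
  have h3 : (0 : ℝ) < √3 := by positivity
  have hne : ∀ {x y : R3} (i : Fin 3), x i ≠ y i → x ≠ y := fun i h hxy => h (by rw [hxy])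
  have hup : upperVertices.ncard = 3 := Set.ncard_eq_three.2
    ⟨_, _, _, hne 1 (by norm_num [verticalUnit]), hne 1 (by norm_num [verticalUnit]),
      hne 0 (by simp [verticalUnit]; linarith), rfl⟩
  have hlow : lowerVertices.ncard = 3 := Set.ncard_eq_three.2
    ⟨_, _, _, hne 0 (by norm_num), hne 0 (by norm_num), hne 1 (by simp; linarith), rfl⟩
  have hdisj : Disjoint upperVertices lowerVertices := by
    rw [Set.disjoint_left]
    rintro x hx hy
    have h1 : x 2 = 1 := by
      rcases hx with rfl | rfl | rfl <;> simp [verticalUnit]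
    have h0 : x 2 = 0 := by
      rcases hy with rfl | rfl | rfl <;> simp
    exact one_ne_zero (h1.symm.trans h0)
  rw [sixPoints, Set.ncard_union_eq hdisj (Set.finite_of_ncard_ne_zero (by simp [hup]))
    (Set.finite_of_ncard_ne_zero (by simp [hlow])), hup, hlow]

theorem theorem1 :
    ∃ N : Seminorm ℝ R3,
      IsSmoothNorm N ∧
      sixPoints.ncard = 6 ∧
      IsEquilateral N sixPoints ∧
      polytopeP - polytopeP ⊆ unitBall N ∧
      hexagon ∪ -hexagon ⊆ frontier (unitBall N) ∧
      dodecagonVertices ⊆ frontier (unitBall N) := by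
  obtain ⟨N, hzero, hsmooth, hone⟩ := exists_smooth_norm_of_functionals facetFunctional
    eq_zero_of_facetFunctional_eq_zero (a := 19 / 20) (by norm_num) (by norm_num)
  have hhex : ∀ v ∈ hexagon, N v = 1 := fun v hv => by
    obtain ⟨h0, hj⟩ := facetFunctional_of_mem_hexagon hv
    exact hone v 0 (by rw [h0, abs_one]) hj
  have hdod : ∀ v ∈ dodecagonVertices, N v = 1 := fun v hv => by
    obtain ⟨i, hi, hj⟩ := facetFunctional_of_mem_dodecagonVertices hv
    exact hone v i hi hj
  have hdist : ∀ x ∈ sixPoints, ∀ y ∈ sixPoints, x ≠ y → N (x - y) = 1 := by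
    rintro x (hx | hx) y (hy | hy) hxy
    · exact hdod _ ⟨x, y, hxy, rfl, .inl ⟨hx, hy⟩⟩
    · exact hhex _ (sub_mem_hexagon hx hy)
    · rw [map_sub_rev]
      exact hhex _ (sub_mem_hexagon hy hx)
    · exact hdod _ ⟨x, y, hxy, rfl, .inr ⟨hx, hy⟩⟩
  refine ⟨N, ⟨hzero, hsmooth⟩, ncard_sixPoints, ⟨1, one_pos, hdist⟩, ?_, ?_,
    fun v hv => mem_frontier_unitBall (hdod v hv)⟩
  · have hconv : Convex ℝ (unitBall N) := by
      simpa [unitBall] using N.convexOn.convex_le 1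
    rw [polytopeP, ← convexHull_sub]
    refine convexHull_min ?_ hconv
    rintro _ ⟨x, hx, y, hy, rfl⟩
    by_cases hxy : x = y
    · simp [unitBall, hxy]
    · exact (hdist x hx y hy hxy).le
  · rintro v (hv | hv)
    · exact mem_frontier_unitBall (hhex v hv)
    · exact mem_frontier_unitBall (by rw [← map_neg_eq_map]; exact hhex _ hv)
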